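/- Let $k$ be a finite field, $\widetilde Q$ a finite acyclic quiver, some of whose vertices are frozen, and $Q$ the full subquiver on the non-frozen vertices; $kQ$-modules are regarded as $k\widetilde Q$-modules (representations of $\widetilde Q$ vanishing at the frozen vertices). All modules are finite-dimensional. Let $\tau$ be the Auslander--Reiten translation of $k\widetilde Q$-modules, let $$\langle X,Y\rangle=\dim_k\operatorname{Hom}_{k\widetilde Q}(X,Y)-\dim_k\operatorname{Ext}^1_{k\widetilde Q}(X,Y)$$ be the Euler form, and let $\mathcal C_{\widetilde Q}$ be the cluster category, i.e. the orbit category of $\mathcal D^b(\operatorname{mod}k\widetilde Q)$ by $F=\tau\circ[-1]$, so that $\operatorname{Ext}^1_{\mathcal C_{\widetilde Q}}(X,Y)=\bigoplus_{i\in\mathbb Z}\operatorname{Hom}_{\mathcal D^b}(X,F^i(Y[1]))$. Let $M,N$ be indecomposable rigid $kQ$-modules (rigid: $\operatorname{Ext}^1(X,X)=0$) with $\dim_k\operatorname{Ext}^1_{\mathcal C_{\widetilde Q}}(M,N)=1$, and let $$0\longrightarrow D_0\longrightarrow N\xrightarrow{\ f\ }\tau M\longrightarrow \tau A\oplus I\longrightarrow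 0$$ be an exact sequence of $k\widetilde Q$-modules with $f\neq 0$, $I$ injective and $A$ without nonzero projective direct summands. Write $M\cong M'\oplus P_0$ with $P_0$ projective and $M'$ without nonzero projective direct summands, and let $A_0\cong A\oplus P_0$. Then $$\tfrac12\langle A_0,D_0\rangle-\tfrac12\langle M,N\rangle=\tfrac12 .$$ -/

import Mathlib

open CategoryTheory CategoryTheory.Limits
open scoped DirectSum

universe u

noncomputable section

namespace ClusterQuiver

/-- A quiver is acyclic if the only paths from a vertex to itself are the trivial ones. -/
def IsAcyclicQuiver (V : Type) [Quiver.{0} V] : Prop :=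
  ∀ (x : V) (p : Quiver.Path x x), p = Quiver.Path.nil

/-- The category of `k`-linear representations of the quiver `V`, i.e. of modules over its path
algebra `kV`: a vector space at every vertex and a linear map for every arrow (extended to
paths). -/
abbrev QRep (k : Type u) [Field k] (V : Type) [Quiver.{0} V] : Type (u + 1) :=
  Paths V ⥤ ModuleCat.{u} k

section Quiver

variable {k : Type u} [Field k] {V : Type} [Quiver.{0} V]

namespace QRep

/-- The vector space `M(x)` of a representation `M` at a vertex `x`. -/
def space (M : QRep k V) (x : V) : Type u := M.obj x

instance (M : QRep k V) (x : V) : AddCommGroup (space M x) := inferInstanceAs (AddCommGroup (M.obj x))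

instance (M : QRep k V) (x : V) : Module k (space M x) := inferInstanceAs (Module k (M.obj x))

/-- The linear map `M(p) : M(x) → M(y)` along a path `p` from `x` to `y`. -/
def along (M : QRep k V) {x y : V} (p : Quiver.Path x y) : space M x →ₗ[k] space M y :=
  (M.map (X := x) (Y := y) p).hom

/-- The component of a morphism of representations at a vertex. -/
def compAt {M N : QRep k V} (h : M ⟶ N) (x : V) : space M x →ₗ[k] space N x :=
  (h.app x).hom

lemma compAt_along {M N : QRep k V} (h : M ⟶ N) {x y : V} (p : Quiver.Path x y) (m : space M x) :
    compAt h y (along M p m) = along N p (compAt h x m) :=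
  congrArg (fun φ => φ.hom m) (h.naturality (X := x) (Y := y) p)

section Constructions

variable {E E' : V → Type u} [∀ x, AddCommGroup (E x)] [∀ x, Module k (E x)]
  [∀ x, AddCommGroup (E' x)] [∀ x, Module k (E' x)]
  {T : ∀ x y : V, Quiver.Path x y → (E x →ₗ[k] E y)}
  {T' : ∀ x y : V, Quiver.Path x y → (E' x →ₗ[k] E' y)}

variable (T) in
/-- The axioms of a representation for a family of linear maps along the paths. -/
structure IsFunctorial : Prop where
  nil : ∀ (x : V) (e : E x), T x x Quiver.Path.nil e = e
  comp : ∀ {x y z : V} (p : Quiver.Path x y) (q : Quiver.Path y z) (e : E x),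
    T x z (p.comp q) e = T y z q (T x y p e)

/-- The representation given by spaces at the vertices and linear maps along the paths. -/
def mk (hT : IsFunctorial T) : QRep k V where
  obj := fun (x : V) => ModuleCat.of k (E x)
  map := fun {x y : V} p => ModuleCat.ofHom (T x y p)
  map_id := fun (x : V) => ModuleCat.hom_ext (LinearMap.ext (hT.nil x))
  map_comp := fun {_ _ _ : V} p q => ModuleCat.hom_ext (LinearMap.ext (hT.comp p q))

/-- The morphism of representations given by linear maps at the vertices. -/
def mkHom (hT : IsFunctorial T) (hT' : IsFunctorial T') (c : ∀ x : V, E x →ₗ[k] E' x)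
    (hc : ∀ (x y : V) (p : Quiver.Path x y) (e : E x), c y (T x y p e) = T' x y p (c x e)) :
    mk hT ⟶ mk hT' where
  app := fun (x : V) => ModuleCat.ofHom (c x)
  naturality := fun (x y : V) p => ModuleCat.hom_ext (LinearMap.ext (hc x y p))

end Constructions

lemma hom_ext {M N : QRep k V} {f g : M ⟶ N} (h : ∀ (x : V) (m : space M x),
    compAt f x m = compAt g x m) : f = g :=
  NatTrans.ext (funext fun x => ModuleCat.hom_ext (LinearMap.ext (h x)))

/-- Finite-dimensional representations: the objects of `mod kV`. -/
def IsFiniteDim (M : QRep k V) : Prop := ∀ x : V, Module.Finite k (space M x)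

/-- A representation that vanishes at all frozen vertices.  These are the modules over the path
algebra of the full subquiver on the non-frozen vertices, regarded as modules over `kV`. -/
def IsOverPrincipalPart (frozen : Set V) (M : QRep k V) : Prop :=
  ∀ x : V, x ∈ frozen → Subsingleton (space M x)

/-- `M` has no nonzero projective direct summand. -/
def NoProjectiveSummand (M : QRep k V) : Prop :=
  ∀ P X : QRep k V, Projective P → Nonempty (M ≅ P ⊞ X) → IsZero P

end QRep

instance : HasExt.{u + 1} (QRep k V) := HasExt.standard _

/-- `M` is rigid: `Ext¹(M, M) = 0`. -/
def IsRigid (M : QRep k V) : Prop := Subsingleton (Abelian.Ext.{u + 1} M M 1)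

/-- The Euler form `⟨M, N⟩ = dim Hom(M, N) - dim Ext¹(M, N)` of two representations. -/
def eulerForm (M N : QRep k V) : ℤ :=
  (Module.finrank k (M ⟶ N) : ℤ) - Module.finrank k (Abelian.Ext.{u + 1} M N 1)

/-!
### The Nakayama functor and the Auslander-Reiten translation

For a vertex `x` let `P x` and `I x` be the indecomposable projective and injective
representations at `x`: `P x` has the basis of all paths from `x` to `y` at the vertex `y`, and
`I x` is the space of functions on the paths from `y` to `x` at the vertex `y`.
Every representation `M` has the standard projective resolution
`0 → ⨁_{a : s ⟶ t} P t ⊗ M s → ⨁_x P x ⊗ M x → M → 0`, whose first map sends `p ⊗ m`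
(in the summand of an arrow `a : s ⟶ t`) to `(a p) ⊗ m - p ⊗ M(a) m`.
The Nakayama functor `D Hom(-, kV)` sends `P x` to `I x`; it turns the first map of the resolution
into `nakayamaMap : ⨁_{a : s ⟶ t} I t ⊗ M s → ⨁_x I x ⊗ M x`.  Here `I x ⊗ M x` is, at the
vertex `y`, the space of functions from the paths `y → x` to `M x`.
-/

/-- The structure maps of `⨁_{a : s ⟶ t} I t ⊗ M s`: precomposition of functions on paths. -/
def nakayamaOneAlong (M : QRep k V) (y z : V) (g : Quiver.Path y z) :
    (∀ s t : V, (s ⟶ t) → Quiver.Path y t → QRep.space M s) →ₗ[k]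
      (∀ s t : V, (s ⟶ t) → Quiver.Path z t → QRep.space M s) where
  toFun φ s t a q := φ s t a (g.comp q)
  map_add' _ _ := rfl
  map_smul' _ _ := rfl

lemma nakayamaOneAlong_functorial (M : QRep k V) : QRep.IsFunctorial (nakayamaOneAlong M) where
  nil y φ := by funext s t a q; exact congrArg (φ s t a) q.nil_comp
  comp g h φ := by funext s t a q; exact congrArg (φ s t a) (g.comp_assoc h q)

/-- `⨁_{a : s ⟶ t} I t ⊗ M s`, the value of the Nakayama functor on the first syzygy term of
the standard projective resolution of `M`. -/
def nakayamaOne : QRep k V ⥤ QRep k V where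
  obj M := QRep.mk (nakayamaOneAlong_functorial M)
  map h := QRep.mkHom (nakayamaOneAlong_functorial _) (nakayamaOneAlong_functorial _)
    (fun y =>
      { toFun := fun φ s t a q => QRep.compAt h s (φ s t a q)
        map_add' := fun φ ψ => by funext s t a q; exact map_add _ _ _
        map_smul' := fun c φ => by funext s t a q; exact map_smul _ _ _ })
    (fun _ _ _ _ => rfl)
  map_id _ := rfl
  map_comp _ _ := rfl

/-- The structure maps of `⨁_x I x ⊗ M x`: precomposition of functions on paths. -/
def nakayamaZeroAlong (M : QRep k V) (y z : V) (g : Quiver.Path y z) :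
    (∀ x : V, Quiver.Path y x → QRep.space M x) →ₗ[k]
      (∀ x : V, Quiver.Path z x → QRep.space M x) where
  toFun φ x q := φ x (g.comp q)
  map_add' _ _ := rfl
  map_smul' _ _ := rfl

lemma nakayamaZeroAlong_functorial (M : QRep k V) : QRep.IsFunctorial (nakayamaZeroAlong M) where
  nil y φ := by funext x q; exact congrArg (φ x) q.nil_comp
  comp g h φ := by funext x q; exact congrArg (φ x) (g.comp_assoc h q)

/-- `⨁_x I x ⊗ M x`, the value of the Nakayama functor on the zeroth term of the standard
projective resolution of `M`. -/
def nakayamaZero : QRep k V ⥤ QRep k V where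
  obj M := QRep.mk (nakayamaZeroAlong_functorial M)
  map h := QRep.mkHom (nakayamaZeroAlong_functorial _) (nakayamaZeroAlong_functorial _)
    (fun y =>
      { toFun := fun φ x q => QRep.compAt h x (φ x q)
        map_add' := fun φ ψ => by funext x q; exact map_add _ _ _
        map_smul' := fun c φ => by funext x q; exact map_smul _ _ _ })
    (fun _ _ _ _ => rfl)
  map_id _ := rfl
  map_comp _ _ := rfl

instance : (nakayamaOne (k := k) (V := V)).Additive where
  map_add := QRep.hom_ext fun _ _ => rfl

instance : (nakayamaZero (k := k) (V := V)).Additive where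
  map_add := QRep.hom_ext fun _ _ => rfl

section Finite

variable [Fintype V] [∀ x y : V, Fintype (x ⟶ y)]

/-- The image under the Nakayama functor of the map `p ⊗ m ↦ (a p) ⊗ m - p ⊗ M(a) m`, at a
vertex `y`. -/
def nakayamaMapAt (M : QRep k V) (y : V) :
    (∀ s t : V, (s ⟶ t) → Quiver.Path y t → QRep.space M s) →ₗ[k]
      (∀ x : V, Quiver.Path y x → QRep.space M x) where
  toFun φ x q :=
    (∑ t : V, ∑ a : x ⟶ t, φ x t a (q.cons a)) -
      ∑ s : V, ∑ a : s ⟶ x, QRep.along M a.toPath (φ s x a q)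
  map_add' φ ψ := by
    funext x q
    simp only [Pi.add_apply, map_add, Finset.sum_add_distrib]
    abel
  map_smul' c φ := by
    funext x q
    simp only [Pi.smul_apply, map_smul, ← Finset.smul_sum, ← smul_sub, RingHom.id_apply]

/-- The Nakayama functor applied to the standard projective presentation,
`⨁_{a : s ⟶ t} I t ⊗ M s → ⨁_x I x ⊗ M x`, naturally in `M`. -/
def nakayamaMap : nakayamaOne (k := k) (V := V) ⟶ nakayamaZero where
  app M := QRep.mkHom (nakayamaOneAlong_functorial M) (nakayamaZeroAlong_functorial M)
    (nakayamaMapAt M) (fun _ _ _ _ => rfl)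
  naturality M N h := by
    apply QRep.hom_ext
    intro y φ
    funext x q
    change _ - _ = QRep.compAt h x (_ - _)
    simp only [map_sub, map_sum, QRep.compAt_along]
    rfl

/-- The Auslander-Reiten translation `τ M = D Tr M` on modules: the kernel of the Nakayama functor
applied to the standard projective presentation of `M`. -/
def tau (M : QRep k V) : QRep k V := kernel (nakayamaMap.app M)

/-!
### The inverse Nakayama functor

Dually, every representation `M` has the standard injective resolution
`0 → M → ⨁_x I x ⊗ M x → ⨁_{a : s ⟶ t} I s ⊗ M t → 0`, and the inverse Nakayama functor
`Hom(D kV, -)` sends `I x` to `P x`.  It turns the second map of the resolution into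
`invNakayamaMap : ⨁_x P x ⊗ M x → ⨁_{a : s ⟶ t} P s ⊗ M t`, which sends `p ⊗ m`, `p` a path
starting at `x`, to `∑_{a : s ⟶ x} (a p) ⊗ m - ∑_{a : x ⟶ t} p ⊗ M(a) m`.
Here `P x ⊗ M x` is, at the vertex `y`, the space of finitely supported functions from the paths
`x → y` to `M x`.
-/

end Finite

/-- The structure maps of `⨁_x P x ⊗ M x`: concatenation of paths. -/
def invNakayamaZeroAlong (M : QRep k V) (y z : V) (g : Quiver.Path y z) :
    (∀ x : V, Quiver.Path x y →₀ QRep.space M x) →ₗ[k]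
      (∀ x : V, Quiver.Path x z →₀ QRep.space M x) :=
  LinearMap.pi fun x =>
    Finsupp.lmapDomain (QRep.space M x) k (fun p => p.comp g) ∘ₗ LinearMap.proj x

lemma invNakayamaZeroAlong_functorial (M : QRep k V) :
    QRep.IsFunctorial (invNakayamaZeroAlong M) where
  nil y φ := by funext x; exact Finsupp.mapDomain_id
  comp g h φ := by
    funext x
    refine Eq.trans ?_ Finsupp.mapDomain_comp
    exact congrArg (fun f => Finsupp.mapDomain f (φ x))
      (funext fun p => (p.comp_assoc g h).symm)

/-- `⨁_x P x ⊗ M x`. -/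
def invNakayamaZero : QRep k V ⥤ QRep k V where
  obj M := QRep.mk (invNakayamaZeroAlong_functorial M)
  map h := QRep.mkHom (invNakayamaZeroAlong_functorial _) (invNakayamaZeroAlong_functorial _)
    (fun y => LinearMap.pi fun x =>
      Finsupp.mapRange.linearMap (QRep.compAt h x) ∘ₗ LinearMap.proj x)
    (fun y z g φ => by
      funext x
      exact (Finsupp.mapDomain_mapRange _ _ _ (map_zero (QRep.compAt h x))
        (map_add (QRep.compAt h x))).symm)
  map_id M := QRep.hom_ext fun _ _ => by
    funext x
    exact Finsupp.ext fun _ => rfl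
  map_comp {M N L} h g := QRep.hom_ext fun y φ => by
    funext x
    exact Finsupp.ext fun _ => rfl

/-- The structure maps of `⨁_{a : s ⟶ t} P s ⊗ M t`: concatenation of paths. -/
def invNakayamaOneAlong (M : QRep k V) (y z : V) (g : Quiver.Path y z) :
    (∀ s t : V, (s ⟶ t) → (Quiver.Path s y →₀ QRep.space M t)) →ₗ[k]
      (∀ s t : V, (s ⟶ t) → (Quiver.Path s z →₀ QRep.space M t)) where
  toFun φ s t a := Finsupp.lmapDomain (QRep.space M t) k (fun p => p.comp g) (φ s t a)
  map_add' φ ψ := by funext s t a; exact map_add _ _ _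
  map_smul' c φ := by
    funext s t a
    exact map_smul (Finsupp.lmapDomain (QRep.space M t) k _) c (φ s t a)

lemma invNakayamaOneAlong_functorial (M : QRep k V) :
    QRep.IsFunctorial (invNakayamaOneAlong M) where
  nil y φ := by funext s t a; exact Finsupp.mapDomain_id
  comp g h φ := by
    funext s t a
    refine Eq.trans ?_ Finsupp.mapDomain_comp
    exact congrArg (fun f => Finsupp.mapDomain f (φ s t a))
      (funext fun p => (p.comp_assoc g h).symm)

/-- `⨁_{a : s ⟶ t} P s ⊗ M t`. -/
def invNakayamaOne : QRep k V ⥤ QRep k V where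
  obj M := QRep.mk (invNakayamaOneAlong_functorial M)
  map h := QRep.mkHom (invNakayamaOneAlong_functorial _) (invNakayamaOneAlong_functorial _)
    (fun y =>
      { toFun := fun φ s t a => Finsupp.mapRange.linearMap (QRep.compAt h t) (φ s t a)
        map_add' := fun φ ψ => by funext s t a; exact map_add _ _ _
        map_smul' := fun c φ => by
          funext s t a
          exact map_smul (Finsupp.mapRange.linearMap (QRep.compAt h t)) c (φ s t a) })
    (fun y z g φ => by
      funext s t a
      exact (Finsupp.mapDomain_mapRange _ _ _ (map_zero (QRep.compAt h t))
        (map_add (QRep.compAt h t))).symm)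
  map_id M := QRep.hom_ext fun y φ => by
    funext s t a
    exact Finsupp.ext fun _ => rfl
  map_comp h g := QRep.hom_ext fun y φ => by
    funext s t a
    exact Finsupp.ext fun _ => rfl

instance : (invNakayamaZero (k := k) (V := V)).Additive where
  map_add := QRep.hom_ext fun _ _ => by
    funext x
    exact Finsupp.ext fun _ => rfl

instance : (invNakayamaOne (k := k) (V := V)).Additive where
  map_add := QRep.hom_ext fun _ _ => by
    funext s t a
    exact Finsupp.ext fun _ => rfl

/-- The map `p ⊗ m ↦ ∑_{a : s ⟶ x} (a p) ⊗ m - ∑_{a : x ⟶ t} p ⊗ M(a) m` at a vertex `y`. -/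
def invNakayamaMapAt (M : QRep k V) (y : V) :
    (∀ x : V, Quiver.Path x y →₀ QRep.space M x) →ₗ[k]
      (∀ s t : V, (s ⟶ t) → (Quiver.Path s y →₀ QRep.space M t)) where
  toFun φ s t a :=
    Finsupp.lmapDomain (QRep.space M t) k (fun p => a.toPath.comp p) (φ t) -
      Finsupp.mapRange.linearMap (QRep.along M a.toPath) (φ s)
  map_add' φ ψ := by
    funext s t a
    simp only [Pi.add_apply, map_add]
    abel
  map_smul' c φ := by
    funext s t a
    simp only [Pi.smul_apply, map_smul, ← smul_sub, RingHom.id_apply]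

/-- The inverse Nakayama functor applied to the standard injective copresentation,
`⨁_x P x ⊗ M x → ⨁_{a : s ⟶ t} P s ⊗ M t`, naturally in `M`. -/
def invNakayamaMap : invNakayamaZero (k := k) (V := V) ⟶ invNakayamaOne where
  app M := QRep.mkHom (invNakayamaZeroAlong_functorial M) (invNakayamaOneAlong_functorial M)
    (invNakayamaMapAt M)
    (fun y z g φ => by
      funext s t a
      refine Eq.trans ?_ (map_sub (Finsupp.lmapDomain (QRep.space M t) k (fun p => p.comp g))
        (Finsupp.lmapDomain (QRep.space M t) k (fun p => a.toPath.comp p) (φ t))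
        (Finsupp.mapRange.linearMap (QRep.along M a.toPath) (φ s))).symm
      refine congrArg₂ (fun u v : Quiver.Path s z →₀ QRep.space M t => u - v) ?_ ?_
      · refine Finsupp.mapDomain_comp.symm.trans (Eq.trans ?_ Finsupp.mapDomain_comp)
        exact congrArg (fun f => Finsupp.mapDomain f (φ t))
          (funext fun p => (a.toPath.comp_assoc p g).symm)
      · exact (Finsupp.mapDomain_mapRange _ _ _ (map_zero (QRep.along M a.toPath))
          (map_add (QRep.along M a.toPath))).symm)
  naturality M N h := by
    apply QRep.hom_ext
    intro y (φ : ∀ x : V, Quiver.Path x y →₀ QRep.space M x)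
    funext s t a
    refine Eq.trans ?_ (map_sub (Finsupp.mapRange.linearMap (QRep.compAt h t))
      (Finsupp.lmapDomain (QRep.space M t) k (fun p => a.toPath.comp p) (φ t))
      (Finsupp.mapRange.linearMap (QRep.along M a.toPath) (φ s))).symm
    refine congrArg₂ (fun u v : Quiver.Path s y →₀ QRep.space N t => u - v) ?_ ?_
    · exact Finsupp.mapDomain_mapRange _ _ _ (map_zero (QRep.compAt h t))
        (map_add (QRep.compAt h t))
    · exact Finsupp.ext fun p => (QRep.compAt_along h a.toPath _).symm

/-!
### The cluster category
-/

instance : HasDerivedCategory.{u + 1} (QRep k V) := HasDerivedCategory.standard _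

/-- The derived inverse Nakayama functor (the inverse Serre functor), on complexes: the inverse
Nakayama functor applied to the standard injective resolution
(total complex, i.e. the mapping cone shifted by `-1`). -/
def invSerre (X : CochainComplex (QRep k V) ℤ) : CochainComplex (QRep k V) ℤ :=
  (CochainComplex.mappingCone
    ((NatTrans.mapHomologicalComplex invNakayamaMap (ComplexShape.up ℤ)).app X))⟦(-1 : ℤ)⟧

section Finite

variable [Fintype V] [∀ x y : V, Fintype (x ⟶ y)]

/-- The derived Nakayama functor (the Serre functor), on complexes: the Nakayama functor applied
to the standard projective resolution (total complex, i.e. the mapping cone). -/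
def serre (X : CochainComplex (QRep k V) ℤ) : CochainComplex (QRep k V) ℤ :=
  CochainComplex.mappingCone
    ((NatTrans.mapHomologicalComplex nakayamaMap (ComplexShape.up ℤ)).app X)

/-- The Auslander-Reiten translation of the derived category, `τ = S ∘ [-1]` with `S` the Serre
functor. -/
def derivedTau (X : CochainComplex (QRep k V) ℤ) : CochainComplex (QRep k V) ℤ :=
  (serre X)⟦(-1 : ℤ)⟧

/-- The inverse `τ⁻¹ = S⁻¹ ∘ [1]`. -/
def derivedTauInv (X : CochainComplex (QRep k V) ℤ) : CochainComplex (QRep k V) ℤ :=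
  (invSerre X)⟦(1 : ℤ)⟧

/-- The powers `F ^ i`, `i ∈ ℤ`, of the auto-equivalence `F = τ ∘ [-1]` of the derived category,
on objects (represented by complexes). -/
def orbitPow : ℤ → CochainComplex (QRep k V) ℤ → CochainComplex (QRep k V) ℤ
  | Int.ofNat i => (fun X => derivedTau (X⟦(-1 : ℤ)⟧))^[i]
  | Int.negSucc i => (fun X => derivedTauInv (X⟦(1 : ℤ)⟧))^[i + 1]

/-- The morphisms `X → Y` of the cluster category: it is the orbit category of the derived category
by `F`, so that `Hom(X, Y) = ⨁_{i ∈ ℤ} Hom_D(X, F^i Y)`.  For bounded complexes with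
finite-dimensional cohomology the spaces `Hom_D` are those of the bounded derived category of
`mod kV`, which is a full subcategory of the derived category of all representations. -/
abbrev ClusterHom (X Y : CochainComplex (QRep k V) ℤ) : Type (u + 1) :=
  ⨁ i : ℤ, (DerivedCategory.Q.obj X ⟶ DerivedCategory.Q.obj (orbitPow i Y))

/-- `Ext¹(M, N) = Hom(M, N[1])` in the cluster category, for modules `M` and `N`, regarded as
complexes concentrated in degree `0`. -/
abbrev ClusterExtOne (M N : QRep k V) : Type (u + 1) :=
  ClusterHom ((CochainComplex.singleFunctor (QRep k V) 0).obj M)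
    (((CochainComplex.singleFunctor (QRep k V) 0).obj N)⟦(1 : ℤ)⟧)

end Finite

end Quiver

end ClusterQuiver

end

/-! The Auslander-Reiten formulas dim Hom(Y, τX) = dim Ext¹(X, Y) (`finrank_hom_tau`) and, for X
without projective summands, dim Ext¹(Y, τX) = dim Hom(X, Y) (`finrank_ext_tau`) move everything to
the side of τ. The first one, together with f ≠ 0 and the embedding of Ext¹(M, N) into the cluster
Ext¹, gives dim Hom(N, τM) = dim Ext¹(M, N) = 1. Hence M is not projective, P₀ = 0 and A₀ ≅ A. If
Hom(D₀, τA) = 0 and dim Ext¹(D₀, τA) = dim Ext¹(N, τM), then ⟨A₀, D₀⟩ = dim Hom(M, N) = ⟨M, N⟩ + 1.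

These two facts (`hom_ext_of_exact`) come from cutting the four-term sequence at E = im f. Rigidity
of M gives Hom(M, E) ⊆ Hom(M, τM) = 0, so Ext¹(E, τM) = 0. The category is hereditary
(`subsingleton_ext_two`), so Ext¹(N, E) is a quotient of Ext¹(N, N) = 0 and Ext¹(E, τA) vanishes
with Ext¹(E, τM). Since Hom(N, τM) is spanned by f, also Hom(N, τA) = 0, and the long exact
sequences conclude.

The Auslander-Reiten formulas are linear algebra. Hom(X, Y) and Ext¹(X, Y) are the kernel and
cokernel of `diff X Y`; Hom(Y, τX) and, without projective summands, Ext¹(Y, τX) are the kernel and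
cokernel of `codiff X Y`. The two maps are transposes up to sign for the trace pairing, so they have
equal rank. -/

namespace ClusterQuiver

/-! ### Homological algebra of the four-term sequence. -/

section Homological

open Abelian

universe w v₁ u₁ u₂

variable (k : Type u₂) [Field k] {C : Type u₁} [Category.{v₁} C] [Abelian C] [Linear k C]
  [HasExt.{w} C]

/-- The connecting map `Hom(X, S.X₃) → Ext¹(X, S.X₁)` of a short exact sequence, linearly. -/
noncomputable def connectingHom {S : ShortComplex C} (hS : S.ShortExact) (X : C) :
    (X ⟶ S.X₃) →ₗ[k] Ext.{w} X S.X₁ 1 :=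
  (Ext.postcompOfLinear hS.extClass k X (zero_add 1)).comp
    (Ext.linearEquiv₀ (R := k)).symm.toLinearMap

lemma connectingHom_apply {S : ShortComplex C} (hS : S.ShortExact) (X : C) (g : X ⟶ S.X₃) :
    connectingHom k hS X g = (Ext.mk₀ g).comp hS.extClass (zero_add 1) := by
  simp [connectingHom]

/-- The obstruction to lifting a class lies in Ext¹(X, S.X₂), which vanishes for injective S.X₂. -/
lemma connectingHom_surjective {S : ShortComplex C} (hS : S.ShortExact) [Injective S.X₂] (X : C) :
    Function.Surjective (connectingHom k hS X) := by
  intro x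
  obtain ⟨x₃, rfl⟩ := Ext.covariant_sequence_exact₁ X hS x (Ext.eq_zero_of_injective _) (zero_add 1)
  obtain ⟨g, rfl⟩ := (Ext.mk₀_bijective _ _).2 x₃
  exact ⟨g, connectingHom_apply k hS X g⟩

lemma ker_connectingHom {S : ShortComplex C} (hS : S.ShortExact) (X : C) :
    LinearMap.ker (connectingHom k hS X) = LinearMap.range (Linear.rightComp k X S.g) := by
  ext g
  rw [LinearMap.mem_ker, connectingHom_apply, LinearMap.mem_range]
  constructor
  · intro hg
    obtain ⟨x₂, hx₂⟩ := Ext.covariant_sequence_exact₃ X hS _ _ hg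
    obtain ⟨h, rfl⟩ := (Ext.mk₀_bijective _ _).2 x₂
    rw [Ext.mk₀_comp_mk₀] at hx₂
    exact ⟨h, (Ext.mk₀_bijective _ _).1 hx₂⟩
  · rintro ⟨h, rfl⟩
    rw [Linear.rightComp_apply, ← Ext.mk₀_comp_mk₀, Ext.comp_assoc_of_second_deg_zero,
      hS.comp_extClass, Ext.comp_zero]

/-- If the middle term of a short exact sequence is injective, then `Ext¹(X, S.X₁)` is the
cokernel of `Hom(X, S.X₂) → Hom(X, S.X₃)`. -/
noncomputable def extOneEquiv {S : ShortComplex C} (hS : S.ShortExact) [Injective S.X₂] (X : C) :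
    ((X ⟶ S.X₃) ⧸ LinearMap.range (Linear.rightComp k X S.g)) ≃ₗ[k] Ext.{w} X S.X₁ 1 :=
  (Submodule.quotEquivOfEq _ _ (ker_connectingHom k hS X).symm).trans
    ((connectingHom k hS X).quotKerEquivOfSurjective (connectingHom_surjective k hS X))

/-- If `Ext²` vanishes, `N` is rigid, `Hom(N, T)` is spanned by `f`, and `Ext¹(im f, T) = 0`, then
`Hom(ker f, B) = 0` and `dim Ext¹(ker f, B) = dim Ext¹(N, T)` for the non-injective part `B` of
the cokernel of `f`. -/
theorem hom_ext_of_exact (hExt : ∀ X Y : C, Subsingleton (Ext.{w} X Y 2)) {N T D B I : C}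
    [Injective I] (j : D ⟶ N) (f : N ⟶ T) (p : T ⟶ B ⊞ I) [Mono j] [Epi p]
    (hjf : j ≫ f = 0) (hfp : f ≫ p = 0) (hN : (ShortComplex.mk j f hjf).Exact)
    (hT : (ShortComplex.mk f p hfp).Exact) (hrig : Subsingleton (Ext.{w} N N 1))
    (hspan : ∀ g : N ⟶ T, ∃ c : k, g = c • f)
    (hET : Subsingleton (Ext.{w} (Limits.image f) T 1)) :
    (∀ g : D ⟶ B, g = 0) ∧
      Module.finrank k (Ext.{w} D B 1) = Module.finrank k (Ext.{w} N T 1) := by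
  have hz₁ : j ≫ Limits.factorThruImage f = 0 := by
    rw [← cancel_mono (Limits.image.ι f), Category.assoc, Limits.image.fac, hjf, zero_comp]
  have hz₂ : Limits.image.ι f ≫ p = 0 := by
    rw [← cancel_epi (Limits.factorThruImage f), ← Category.assoc, Limits.image.fac, hfp, comp_zero]
  have hS₁ : (ShortComplex.mk j (Limits.factorThruImage f) hz₁).ShortExact :=
    { exact := by
        let φ : ShortComplex.mk j (Limits.factorThruImage f) hz₁ ⟶ ShortComplex.mk j f hjf :=
          { τ₁ := 𝟙 _, τ₂ := 𝟙 _, τ₃ := Limits.image.ι f }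
        have : Epi φ.τ₁ := inferInstanceAs (Epi (𝟙 _))
        have : IsIso φ.τ₂ := inferInstanceAs (IsIso (𝟙 _))
        have : Mono φ.τ₃ := inferInstanceAs (Mono (Limits.image.ι f))
        exact (ShortComplex.exact_iff_of_epi_of_isIso_of_mono φ).2 hN }
  have hS₂ : (ShortComplex.mk (Limits.image.ι f) p hz₂).ShortExact :=
    { exact := by
        let φ : ShortComplex.mk f p hfp ⟶ ShortComplex.mk (Limits.image.ι f) p hz₂ :=
          { τ₁ := Limits.factorThruImage f, τ₂ := 𝟙 _, τ₃ := 𝟙 _ }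
        have : Epi φ.τ₁ := inferInstanceAs (Epi (Limits.factorThruImage f))
        have : IsIso φ.τ₂ := inferInstanceAs (IsIso (𝟙 _))
        have : Mono φ.τ₃ := inferInstanceAs (Mono (𝟙 _))
        exact (ShortComplex.exact_iff_of_epi_of_isIso_of_mono φ).1 hT }
  -- Ext¹(N, im f) sits between Ext¹(N, N) = 0 and Ext²(N, D) = 0.
  have hNE : ∀ x : Ext.{w} N (Limits.image f) 1, x = 0 := fun x => by
    obtain ⟨y, rfl⟩ := Ext.covariant_sequence_exact₃ N hS₁ x rfl (Subsingleton.elim _ _)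
    rw [Subsingleton.elim y 0, Ext.zero_comp]
  -- By `hNE` the map lifts through p; the lift is a multiple of f, and f ≫ p = 0.
  have hNC : ∀ g : N ⟶ B ⊞ I, g = 0 := fun g => by
    obtain ⟨y, hy⟩ := Ext.covariant_sequence_exact₃ N hS₂ (Ext.mk₀ g) (zero_add 1) (hNE _)
    obtain ⟨h, rfl⟩ := (Ext.mk₀_bijective _ _).2 y
    rw [Ext.mk₀_comp_mk₀] at hy
    obtain ⟨c, rfl⟩ := hspan h
    rw [← (Ext.mk₀_bijective _ _).1 hy]
    exact (Linear.smul_comp ..).trans (by rw [hfp, smul_zero])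
  -- Push x into B ⊞ I, lift it to Ext¹(im f, T) = 0 (the obstruction is in Ext²), and project back
  -- to B.
  have hEB : ∀ x : Ext.{w} (Limits.image f) B 1, x = 0 := fun x => by
    obtain ⟨y, hy⟩ := Ext.covariant_sequence_exact₃ _ hS₂
      (x.comp (Ext.mk₀ biprod.inl) (add_zero 1)) rfl (Subsingleton.elim _ _)
    have : (x.comp (Ext.mk₀ biprod.inl) (add_zero 1)).comp
        (Ext.mk₀ (biprod.fst : B ⊞ I ⟶ B)) (add_zero 1) = x := by
      rw [Ext.comp_assoc_of_third_deg_zero, Ext.mk₀_comp_mk₀, biprod.inl_fst, Ext.comp_mk₀_id]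
    rw [← this, ← hy, Subsingleton.elim y 0, Ext.zero_comp, Ext.zero_comp]
  refine ⟨fun g => ?_, ?_⟩
  -- Since Ext¹(im f, B) = 0, g extends along j to a map on N, which is zero by `hNC`.
  · obtain ⟨y, hy⟩ := Ext.contravariant_sequence_exact₁ hS₁ B (Ext.mk₀ g) (add_zero 1) (hEB _)
    obtain ⟨h, rfl⟩ := (Ext.mk₀_bijective _ _).2 y
    rw [Ext.mk₀_comp_mk₀] at hy
    have h0 : h = 0 := by
      rw [← Category.comp_id h, ← biprod.inl_fst (X := B) (Y := I), ← Category.assoc, hNC (h ≫ biprod.inl),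
        zero_comp]
    rw [← (Ext.mk₀_bijective _ _).1 hy, h0, comp_zero]
  -- Ext¹(N, I) = 0, so this is in effect the map induced by p; Ext¹ and Ext² from N to im f vanish
  -- on either side of it.
  · have e₁ : Function.Bijective
        (Ext.postcompOfLinear (Ext.mk₀ (p ≫ biprod.fst)) k N (add_zero 1) :
          Ext.{w} N T 1 →ₗ[k] Ext.{w} N B 1) := by
      constructor
      · rw [← LinearMap.ker_eq_bot, LinearMap.ker_eq_bot']
        intro x hx
        have hx' : (x.comp (Ext.mk₀ p) (add_zero 1)).comp
            (Ext.mk₀ (biprod.fst : B ⊞ I ⟶ B)) (add_zero 1) = 0 := by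
          rw [Ext.comp_assoc_of_third_deg_zero, Ext.mk₀_comp_mk₀]
          exact hx
        have hp : x.comp (Ext.mk₀ p) (add_zero 1) = 0 := by
          rw [← Ext.comp_mk₀_id (x.comp (Ext.mk₀ p) (add_zero 1)), ← biprod.total, Ext.mk₀_add,
            Ext.comp_add, ← Ext.mk₀_comp_mk₀, ← Ext.mk₀_comp_mk₀,
            ← Ext.comp_assoc_of_third_deg_zero, ← Ext.comp_assoc_of_third_deg_zero, hx',
            Ext.eq_zero_of_injective ((x.comp (Ext.mk₀ p) (add_zero 1)).comp
              (Ext.mk₀ (biprod.snd : B ⊞ I ⟶ I)) (add_zero 1)),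
            Ext.zero_comp, Ext.zero_comp, add_zero]
        obtain ⟨y, rfl⟩ := Ext.covariant_sequence_exact₂ N hS₂ x hp
        rw [hNE y, Ext.zero_comp]
      · intro z
        obtain ⟨x, hx⟩ := Ext.covariant_sequence_exact₃ N hS₂
          (z.comp (Ext.mk₀ biprod.inl) (add_zero 1)) rfl (Subsingleton.elim _ _)
        refine ⟨x, ?_⟩
        change x.comp (Ext.mk₀ (p ≫ biprod.fst)) (add_zero 1) = z
        rw [← Ext.mk₀_comp_mk₀, ← Ext.comp_assoc_of_third_deg_zero]
        change (x.comp (Ext.mk₀ p) _) = _ at hx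
        rw [hx, Ext.comp_assoc_of_third_deg_zero, Ext.mk₀_comp_mk₀, biprod.inl_fst,
          Ext.comp_mk₀_id]
    -- Here the neighbours are Ext¹(im f, B) and Ext²(im f, B), both zero.
    have e₂ : Function.Bijective
        (Ext.precompOfLinear (Ext.mk₀ j) k B (zero_add 1) :
          Ext.{w} N B 1 →ₗ[k] Ext.{w} D B 1) := by
      constructor
      · rw [← LinearMap.ker_eq_bot, LinearMap.ker_eq_bot']
        intro x hx
        obtain ⟨y, rfl⟩ := Ext.contravariant_sequence_exact₂ hS₁ B x hx
        rw [hEB y, Ext.comp_zero]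
      · intro z
        exact Ext.contravariant_sequence_exact₁ hS₁ B z rfl (Subsingleton.elim _ _)
    rw [← (LinearEquiv.ofBijective _ e₂).finrank_eq, ← (LinearEquiv.ofBijective _ e₁).finrank_eq]

end Homological

end ClusterQuiver

noncomputable section

namespace ClusterQuiver

variable {k : Type u} [Field k] {V : Type} [Quiver.{0} V]

/-! ### Representations described vertex by vertex. -/

namespace QRep

/-- The morphism of representations given by linear maps at the vertices that commute with the
maps along the paths. -/
def homMk {M N : QRep k V} (c : ∀ x, space M x →ₗ[k] space N x)
    (hc : ∀ (x y : V) (p : Quiver.Path x y) (m : space M x),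
      c y (along M p m) = along N p (c x m)) : M ⟶ N where
  app := fun (x : V) => ModuleCat.ofHom (c x)
  naturality := fun (x y : V) p => ModuleCat.hom_ext (LinearMap.ext (hc x y p))

lemma along_nil (M : QRep k V) {x : V} (m : space M x) : along M Quiver.Path.nil m = m :=
  congrArg (fun φ => φ.hom m) (M.map_id x)

lemma along_comp (M : QRep k V) {x y z : V} (p : Quiver.Path x y) (q : Quiver.Path y z)
    (m : space M x) : along M (p.comp q) m = along M q (along M p m) :=
  congrArg (fun φ => φ.hom m) (M.map_comp (X := x) (Y := y) (Z := z) p q)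

lemma along_cons (M : QRep k V) {x y z : V} (p : Quiver.Path x y) (a : y ⟶ z) (m : space M x) :
    along M (p.cons a) m = along M a.toPath (along M p m) :=
  along_comp M p a.toPath m

lemma compAt_comp {L M N : QRep k V} (f : L ⟶ M) (g : M ⟶ N) (x : V) (m : space L x) :
    compAt (f ≫ g) x m = compAt g x (compAt f x m) := rfl

lemma mono_iff {M N : QRep k V} (f : M ⟶ N) :
    Mono f ↔ ∀ x, Function.Injective (compAt f x) := by
  rw [NatTrans.mono_iff_mono_app]
  exact forall_congr' fun x => ModuleCat.mono_iff_injective _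

lemma epi_iff {M N : QRep k V} (f : M ⟶ N) :
    Epi f ↔ ∀ x, Function.Surjective (compAt f x) := by
  rw [NatTrans.epi_iff_epi_app]
  exact forall_congr' fun x => ModuleCat.epi_iff_surjective _

lemma IsFiniteDim.of_mono {M N : QRep k V} (hN : N.IsFiniteDim) (f : M ⟶ N) [Mono f] :
    M.IsFiniteDim := fun x =>
  have := hN x
  Module.Finite.of_injective (compAt f x) ((mono_iff f).1 inferInstance x)

lemma IsFiniteDim.of_epi {M N : QRep k V} (hM : M.IsFiniteDim) (f : M ⟶ N) [Epi f] :
    N.IsFiniteDim := fun x =>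
  have := hM x
  Module.Finite.of_surjective (compAt f x) ((epi_iff f).1 inferInstance x)

/-! ### Coinduced representations and their injectivity. -/

section Coinduced

variable {ι : Type} (v : ι → V) (E : ι → Type u) [∀ i, AddCommGroup (E i)] [∀ i, Module k (E i)]

/-- The structure maps of `⨁ᵢ I (v i) ⊗ E i`: precomposition of functions on paths. -/
def coindAlong (y z : V) (g : Quiver.Path y z) :
    (∀ i, Quiver.Path y (v i) → E i) →ₗ[k] (∀ i, Quiver.Path z (v i) → E i) where
  toFun φ i q := φ i (g.comp q)
  map_add' _ _ := rfl
  map_smul' _ _ := rfl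

lemma coindAlong_functorial : IsFunctorial (coindAlong (k := k) v E) where
  nil y φ := by funext i q; exact congrArg (φ i) q.nil_comp
  comp g h φ := by funext i q; exact congrArg (φ i) (g.comp_assoc h q)

/-- The injective representation `⨁ᵢ I (v i) ⊗ E i`. -/
def coind : QRep k V := mk (coindAlong_functorial (k := k) v E)

variable {v E} in
-- Naturality along q: a morphism into a coinduced representation is determined by its values at
-- trivial paths.
lemma compAt_coind {Y : QRep k V} (h : Y ⟶ coind v E) {y : V} (m : space Y y) (i : ι)
    (q : Quiver.Path y (v i)) :
    (show ∀ i, Quiver.Path y (v i) → E i from compAt h y m) i q =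
      (show ∀ j, Quiver.Path (v i) (v j) → E j from compAt h (v i) (along Y q m)) i
        Quiver.Path.nil := by
  rw [compAt_along]
  rfl

/-- Morphisms into `⨁ᵢ I (v i) ⊗ E i` are families of linear maps. -/
def coindHomEquiv (Y : QRep k V) :
    (Y ⟶ coind v E) ≃ₗ[k] (∀ i, space Y (v i) →ₗ[k] E i) where
  toFun h i := LinearMap.proj Quiver.Path.nil ∘ₗ LinearMap.proj i ∘ₗ
    (show space Y (v i) →ₗ[k] (∀ j, Quiver.Path (v i) (v j) → E j) from compAt h (v i))
  map_add' _ _ := rfl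
  map_smul' _ _ := rfl
  invFun c := homMk (N := coind v E) (fun y =>
      show space Y y →ₗ[k] (∀ j, Quiver.Path y (v j) → E j) from
        LinearMap.pi fun i => LinearMap.pi fun q => c i ∘ₗ along Y q) fun x y p m => by
      funext i q
      exact congrArg (c i) (along_comp Y p q m).symm
  left_inv h := hom_ext fun y m => by
    funext i q
    exact (compAt_coind h m i q).symm
  right_inv c := by
    funext i
    ext m
    exact congrArg (c i) (along_nil Y m)

lemma coindHomEquiv_comp {X Y : QRep k V} (f : X ⟶ Y) (h : Y ⟶ coind v E) (i : ι) :
    coindHomEquiv v E X (f ≫ h) i = coindHomEquiv v E Y h i ∘ₗ compAt f (v i) := rfl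

/-- Left inverses of f at the single vertices suffice, with no compatibility along arrows, because
`coindHomEquiv` allows arbitrary families of linear maps. -/
instance : Injective (coind (k := k) v E) where
  factors {X Y} g f hf := by
    choose r hr using fun x => LinearMap.exists_leftInverse_of_injective (compAt f x)
      (LinearMap.ker_eq_bot.2 ((mono_iff f).1 hf x))
    refine ⟨(coindHomEquiv v E Y).symm fun i => coindHomEquiv v E X g i ∘ₗ r (v i), ?_⟩
    apply (coindHomEquiv v E X).injective
    funext i
    rw [coindHomEquiv_comp, LinearEquiv.apply_symm_apply, LinearMap.comp_assoc, hr,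
      LinearMap.comp_id]

end Coinduced

/-! ### The standard injective resolution and heredity. -/

section Resolution

variable (V) in
/-- The arrows of a quiver, with their sources and targets. -/
abbrev Arr : Type := Σ s t : V, (s ⟶ t)

variable (M : QRep k V)

/-- The zeroth term `⨁_x I x ⊗ M x` of the standard injective resolution. -/
abbrev resZero : QRep k V := coind (k := k) (fun x : V => x) (fun x => space M x)

/-- The first term `⨁_{a : s ⟶ t} I s ⊗ M t` of the standard injective resolution. -/
abbrev resOne : QRep k V := coind (k := k) (fun a : Arr V => a.1) (fun a => space M a.2.1)

/-- The augmentation of the standard injective resolution. -/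
def resι : M ⟶ resZero M := (coindHomEquiv _ _ M).symm fun _ => LinearMap.id

/-- The differential of the standard injective resolution at a vertex. -/
def resdAt (y : V) : (∀ x, Quiver.Path y x → space M x) →ₗ[k]
    (∀ a : Arr V, Quiver.Path y a.1 → space M a.2.1) where
  toFun φ a q := φ a.2.1 (q.cons a.2.2) - along M a.2.2.toPath (φ a.1 q)
  map_add' φ ψ := by
    funext a q
    simp only [Pi.add_apply, map_add]
    abel
  map_smul' c φ := by
    funext a q
    simp only [Pi.smul_apply, map_smul, smul_sub, RingHom.id_apply]

/-- The differential of the standard injective resolution. -/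
def resd : resZero M ⟶ resOne M :=
  homMk (M := resZero M) (N := resOne M) (resdAt M) fun _ _ _ _ => rfl

lemma resι_apply {y : V} (m : space M y) :
    compAt (resι M) y m = fun _ q => along M q m := rfl

lemma resd_apply {y : V} (φ : ∀ x, Quiver.Path y x → space M x) :
    compAt (resd M) y φ =
      fun a q => φ a.2.1 (q.cons a.2.2) - along M a.2.2.toPath (φ a.1 q) := rfl

lemma resι_resd : resι M ≫ resd M = 0 := hom_ext fun y m => by
  rw [compAt_comp, resι_apply, resd_apply]
  funext a q
  exact sub_eq_zero.2 (along_cons M q a.2.2 m)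

/-- A cocycle satisfies φ(qa) = M(a) φ(q) for every arrow a; induct on the path. -/
lemma eq_along_of_resd_eq_zero {y : V} (φ : ∀ x, Quiver.Path y x → space M x)
    (hφ : compAt (resd M) y φ = (0 : ∀ a : Arr V, Quiver.Path y a.1 → space M a.2.1)) (x : V)
    (q : Quiver.Path y x) : φ x q = along M q (φ y Quiver.Path.nil) := by
  induction q with
  | nil => exact (along_nil M _).symm
  | cons q a ih =>
    rw [along_cons, ← ih]
    exact sub_eq_zero.1 (congrFun (congrFun hφ ⟨_, _, a⟩) q)

instance : Mono (resι M) := (mono_iff _).2 fun y m n h => by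
  have := congrFun (congrFun h y) Quiver.Path.nil
  exact (along_nil M m).symm.trans (this.trans (along_nil M n))

/-- A preimage under the differential of the standard injective resolution, by recursion on the
length of a path. -/
def resdInv {y : V} (ψ : ∀ a : Arr V, Quiver.Path y a.1 → space M a.2.1) :
    ∀ {x : V}, Quiver.Path y x → space M x
  | _, Quiver.Path.nil => 0
  | _, Quiver.Path.cons q a => along M a.toPath (resdInv ψ q) + ψ ⟨_, _, a⟩ q

instance : Epi (resd M) := (epi_iff _).2 fun y ψ => by
  refine ⟨fun x q => resdInv M ψ q, ?_⟩
  rw [resd_apply]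
  funext a q
  exact add_sub_cancel_left _ _

/-- The standard injective resolution. -/
abbrev resComplex : ShortComplex (QRep k V) := ShortComplex.mk (resι M) (resd M) (resι_resd M)

lemma resComplex_shortExact : (resComplex M).ShortExact where
  exact := ShortComplex.exact_of_f_is_kernel _
    (KernelFork.IsLimit.ofι' (resι M) (resι_resd M) fun {Z} h hh => by
      have key : ∀ {y : V} (m : space Z y) (x : V) (q : Quiver.Path y x),
          (show ∀ x, Quiver.Path y x → space M x from compAt h y m) x q = along M q
            ((show ∀ x, Quiver.Path y x → space M x from compAt h y m) y Quiver.Path.nil) :=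
        fun {y} m x q => eq_along_of_resd_eq_zero M _
          (congrArg (fun f : Z ⟶ resOne M => compAt f y m) hh) x q
      refine ⟨homMk (fun y => coindHomEquiv _ _ Z h y) fun x y p m => ?_, ?_⟩
      · exact (compAt_coind h m y p).symm.trans (key m y p)
      · refine hom_ext fun y m => ?_
        funext x q
        exact (key m x q).symm)
  mono_f := inferInstanceAs (Mono (resι M))
  epi_g := inferInstanceAs (Epi (resd M))

/-- `Ext²` vanishes: the category of representations of a quiver is hereditary. -/
lemma subsingleton_ext_two (X Y : QRep k V) : Subsingleton (Abelian.Ext.{u + 1} X Y 2) :=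
  subsingleton_of_forall_eq 0 fun x => by
    -- The resolution has length one: Ext²(X, Y) is hit by Ext¹ into the last term, which is
    -- injective too.
    have : Injective (resComplex Y).X₂ := inferInstanceAs (Injective (resZero Y))
    have : Injective (resComplex Y).X₃ := inferInstanceAs (Injective (resOne Y))
    obtain ⟨y, rfl⟩ := Abelian.Ext.covariant_sequence_exact₁ X (resComplex_shortExact Y) x
      (Abelian.Ext.eq_zero_of_injective _) (n₀ := 1) rfl
    rw [Abelian.Ext.eq_zero_of_injective y, Abelian.Ext.zero_comp]

end Resolution

/-! ### Hom and Ext¹ as kernel and cokernel of one linear map. -/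

section Differential

variable (X Y : QRep k V)

/-- The map `(u_x) ↦ (u_t X(a) - Y(a) u_s)`, whose kernel is `Hom(X, Y)` and whose cokernel is
`Ext¹(X, Y)`. -/
def diff : (∀ x, space X x →ₗ[k] space Y x) →ₗ[k]
    (∀ a : Arr V, space X a.1 →ₗ[k] space Y a.2.1) where
  toFun u a := u a.2.1 ∘ₗ along X a.2.2.toPath - along Y a.2.2.toPath ∘ₗ u a.1
  map_add' u w := by
    funext a
    simp only [Pi.add_apply, LinearMap.add_comp, LinearMap.comp_add]
    abel
  map_smul' c u := by
    funext a
    simp only [Pi.smul_apply, LinearMap.smul_comp, LinearMap.comp_smul, smul_sub,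
      RingHom.id_apply]

lemma coindHomEquiv_resd (h : X ⟶ resZero Y) :
    coindHomEquiv _ _ X (h ≫ resd Y) = diff X Y (coindHomEquiv _ _ X h) := by
  funext a
  ext m
  exact congrArg (fun n => n - along Y a.2.2.toPath (coindHomEquiv _ _ X h a.1 m))
    (compAt_coind h m a.2.1 (Quiver.Path.nil.cons a.2.2))

/-- `Hom(X, Y)` is the kernel of `diff X Y`. -/
def homEquiv : (X ⟶ Y) ≃ₗ[k] LinearMap.ker (diff X Y) where
  toFun f := ⟨fun x => compAt f x, by
    rw [LinearMap.mem_ker]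
    funext a
    ext m
    exact sub_eq_zero.2 (compAt_along f a.2.2.toPath m)⟩
  map_add' _ _ := rfl
  map_smul' _ _ := rfl
  invFun u := homMk u.1 fun x y p m => by
    induction p with
    | nil => rw [along_nil, along_nil]
    | cons p a ih =>
      rw [along_cons, along_cons, ← ih]
      exact sub_eq_zero.1 (LinearMap.congr_fun (congrFun (LinearMap.mem_ker.1 u.2) ⟨_, _, a⟩) _)
  left_inv _ := rfl
  right_inv _ := rfl

/-- `Ext¹(X, Y)` is the cokernel of `diff X Y`. -/
def extEquiv : ((∀ a : Arr V, space X a.1 →ₗ[k] space Y a.2.1) ⧸ LinearMap.range (diff X Y))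
    ≃ₗ[k] Abelian.Ext.{u + 1} X Y 1 :=
  haveI : Injective (resComplex Y).X₂ := inferInstanceAs (Injective (resZero Y))
  (Submodule.Quotient.equiv _ _
    (coindHomEquiv (fun a : Arr V => a.1) (fun a => space Y a.2.1) X) (by
    have h : (coindHomEquiv (fun a : Arr V => a.1) (fun a => space Y a.2.1) X).toLinearMap ∘ₗ
        Linear.rightComp k X (resd Y) =
        diff X Y ∘ₗ (coindHomEquiv (fun x : V => x) (space Y) X).toLinearMap :=
      LinearMap.ext (coindHomEquiv_resd X Y)
    exact ((LinearMap.range_comp _ _).symm.trans (congrArg LinearMap.range h)).trans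
      (LinearMap.range_comp_of_range_eq_top _ (LinearEquiv.range _)))).symm.trans
    (extOneEquiv k (resComplex_shortExact Y) X)

end Differential

end QRep

end ClusterQuiver

end

noncomputable section

namespace ClusterQuiver

/-! ### Trace pairings and ranks of adjoint maps. -/

section LinearAlgebra

variable {k : Type u} [Field k]

/-- The trace pairing between `∏ Hom(B i, A i)` and `∏ Hom(A i, B i)`. -/
def tracePairing {ι : Type} [Fintype ι] (A B : ι → Type u) [∀ i, AddCommGroup (A i)]
    [∀ i, Module k (A i)] [∀ i, AddCommGroup (B i)] [∀ i, Module k (B i)] :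
    (∀ i, B i →ₗ[k] A i) →ₗ[k] Module.Dual k (∀ i, A i →ₗ[k] B i) :=
  LinearMap.mk₂ k (fun v u => ∑ i, LinearMap.trace k (A i) (v i ∘ₗ u i))
    (fun v w u => by
      simp only [Pi.add_apply, LinearMap.add_comp, map_add, Finset.sum_add_distrib])
    (fun c v u => by
      simp only [Pi.smul_apply, LinearMap.smul_comp, map_smul, Finset.smul_sum])
    (fun v u w => by
      simp only [Pi.add_apply, LinearMap.comp_add, map_add, Finset.sum_add_distrib])
    (fun c v u => by
      simp only [Pi.smul_apply, LinearMap.comp_smul, map_smul, Finset.smul_sum])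

lemma tracePairing_apply {ι : Type} [Fintype ι] (A B : ι → Type u) [∀ i, AddCommGroup (A i)]
    [∀ i, Module k (A i)] [∀ i, AddCommGroup (B i)] [∀ i, Module k (B i)]
    (v : ∀ i, B i →ₗ[k] A i) (u : ∀ i, A i →ₗ[k] B i) :
    tracePairing A B v u = ∑ i, LinearMap.trace k (A i) (v i ∘ₗ u i) := rfl

/-- Pairing v with the rank-one map a ↦ φ(a) b in coordinate i returns φ(v i b), and functionals
separate vectors. -/
lemma tracePairing_injective {ι : Type} [Fintype ι] (A B : ι → Type u) [∀ i, AddCommGroup (A i)]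
    [∀ i, Module k (A i)] [∀ i, AddCommGroup (B i)] [∀ i, Module k (B i)]
    [∀ i, Module.Finite k (A i)] : Function.Injective (tracePairing (k := k) A B) := by
  classical
  rw [← LinearMap.ker_eq_bot, LinearMap.ker_eq_bot']
  intro v hv
  funext i
  ext b
  refine (Module.forall_dual_apply_eq_zero_iff k (v i b)).1 fun φ => ?_
  have h := LinearMap.congr_fun hv (Pi.single i (φ.smulRight b))
  rw [tracePairing_apply, Finset.sum_eq_single i] at h
  · rw [Pi.single_eq_same] at h
    have : v i ∘ₗ φ.smulRight b = φ.smulRight (v i b) := by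
      ext a
      simp
    rw [this, LinearMap.trace_smulRight] at h
    exact h
  · intro j _ hj
    rw [Pi.single_eq_of_ne hj, LinearMap.comp_zero, map_zero]
  · exact fun h => absurd (Finset.mem_univ i) h

lemma sum_comp_linear {ι : Type} (s : Finset ι) {A B C : Type u} [AddCommGroup A] [Module k A]
    [AddCommGroup B] [Module k B] [AddCommGroup C] [Module k C] (f : ι → (B →ₗ[k] C))
    (g : A →ₗ[k] B) : (∑ i ∈ s, f i) ∘ₗ g = ∑ i ∈ s, f i ∘ₗ g :=
  map_sum (LinearMap.lcomp k C g) f s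

lemma finrank_pi_hom_comm {ι : Type} [Fintype ι] (A B : ι → Type u) [∀ i, AddCommGroup (A i)]
    [∀ i, Module k (A i)] [∀ i, AddCommGroup (B i)] [∀ i, Module k (B i)]
    [∀ i, Module.Finite k (A i)] [∀ i, Module.Finite k (B i)] :
    Module.finrank k (∀ i, B i →ₗ[k] A i) = Module.finrank k (∀ i, A i →ₗ[k] B i) := by
  rw [Module.finrank_pi_fintype, Module.finrank_pi_fintype]
  exact Finset.sum_congr rfl fun i _ => by
    rw [Module.finrank_linearMap, Module.finrank_linearMap, mul_comm]

variable {U W U' W' : Type*} [AddCommGroup U] [Module k U] [AddCommGroup W] [Module k W]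
  [AddCommGroup U'] [Module k U'] [AddCommGroup W'] [Module k W']
  [Module.Finite k W] [Module.Finite k W']

/-- Adjointness reads ψ ∘ d' = dᵗ ∘ (-Φ). As Φ is bijective by dimension and ψ is injective, d' has
the rank of dᵗ, hence of d. Only W and W' need to be finite-dimensional. -/
lemma finrank_range_of_adjoint (d : U →ₗ[k] W) (d' : W' →ₗ[k] U')
    (ψ : U' →ₗ[k] Module.Dual k U) (Φ : W' →ₗ[k] Module.Dual k W) (hψ : Function.Injective ψ)
    (hΦ : Function.Injective Φ) (hW : Module.finrank k W' = Module.finrank k W)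
    (h : ∀ w u, ψ (d' w) u = -Φ w (d u)) :
    Module.finrank k (LinearMap.range d') = Module.finrank k (LinearMap.range d) := by
  have hsurj : LinearMap.range (-Φ) = ⊤ := by
    rw [LinearMap.range_neg]
    exact LinearMap.range_eq_top.2 ((LinearMap.injective_iff_surjective_of_finrank_eq_finrank
      (hW.trans Subspace.dual_finrank_eq.symm)).1 hΦ)
  have hcomp : ψ ∘ₗ d' = d.dualMap ∘ₗ (-Φ) := by
    ext w u
    exact h w u
  have hr := congrArg LinearMap.range hcomp
  rw [LinearMap.range_comp_of_range_eq_top _ hsurj, LinearMap.range_comp] at hr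
  rw [← LinearMap.finrank_range_dualMap_eq_finrank_range d, ← hr]
  exact (LinearEquiv.finrank_eq (Submodule.equivMapOfInjective ψ hψ _))

end LinearAlgebra

namespace QRep

variable {k : Type u} [Field k] {V : Type} [Quiver.{0} V] [Fintype V]
  [∀ x y : V, Fintype (x ⟶ y)]

/-! ### The Auslander-Reiten formulas. -/

section Codifferential

variable (X Y : QRep k V)

/-- The transpose of `diff X Y` with respect to the trace pairing, up to sign. -/
def codiff : (∀ a : Arr V, space Y a.2.1 →ₗ[k] space X a.1) →ₗ[k]
    (∀ x, space Y x →ₗ[k] space X x) where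
  toFun v x := (∑ t : V, ∑ a : x ⟶ t, v ⟨x, t, a⟩ ∘ₗ along Y a.toPath) -
    ∑ s : V, ∑ a : s ⟶ x, along X a.toPath ∘ₗ v ⟨s, x, a⟩
  map_add' v w := by
    funext x
    simp only [Pi.add_apply, LinearMap.add_comp, LinearMap.comp_add, Finset.sum_add_distrib]
    abel
  map_smul' c v := by
    funext x
    simp only [Pi.smul_apply, LinearMap.smul_comp, LinearMap.comp_smul, ← Finset.smul_sum,
      ← smul_sub, RingHom.id_apply]

variable {X Y} in
-- Over the arrows a : s ⟶ t, both sides are sums of tr(v_a Y(a) u_s) and tr(v_a u_t X(a));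
-- cyclicity of the trace brings the terms with X(a) in front into this form.
lemma tracePairing_codiff (hX : X.IsFiniteDim) (hY : Y.IsFiniteDim)
    (v : ∀ a : Arr V, space Y a.2.1 →ₗ[k] space X a.1) (u : ∀ x, space X x →ₗ[k] space Y x) :
    tracePairing (space X) (space Y) (codiff X Y v) u =
      -tracePairing (fun a : Arr V => space X a.1) (fun a => space Y a.2.1) v (diff X Y u) := by
  have hX' : ∀ x, Module.Finite k (space X x) := hX
  have hY' : ∀ x, Module.Finite k (space Y x) := hY
  have e₁ : tracePairing (space X) (space Y) (codiff X Y v) u =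
      (∑ s : V, ∑ t : V, ∑ a : s ⟶ t,
        LinearMap.trace k (space X s) (v ⟨s, t, a⟩ ∘ₗ along Y a.toPath ∘ₗ u s)) -
      ∑ s : V, ∑ t : V, ∑ a : s ⟶ t,
        LinearMap.trace k (space X s) (v ⟨s, t, a⟩ ∘ₗ u t ∘ₗ along X a.toPath) := by
    rw [Finset.sum_comm (s := Finset.univ) (t := Finset.univ)
      (f := fun s t => ∑ a : s ⟶ t,
        LinearMap.trace k (space X s) (v ⟨s, t, a⟩ ∘ₗ u t ∘ₗ along X a.toPath)),
      ← Finset.sum_sub_distrib, tracePairing_apply]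
    refine Finset.sum_congr rfl fun x _ => ?_
    change LinearMap.trace k (space X x) ((_ - _) ∘ₗ u x) = _
    simp only [LinearMap.sub_comp, sum_comp_linear, map_sub, map_sum, LinearMap.comp_assoc]
    refine congrArg₂ _ rfl ?_
    refine Finset.sum_congr rfl fun s _ => Finset.sum_congr rfl fun a _ => ?_
    rw [LinearMap.trace_comp_comm', LinearMap.comp_assoc]
  have e₂ : tracePairing (fun a : Arr V => space X a.1) (fun a => space Y a.2.1) v (diff X Y u) =
      (∑ s : V, ∑ t : V, ∑ a : s ⟶ t,
        LinearMap.trace k (space X s) (v ⟨s, t, a⟩ ∘ₗ u t ∘ₗ along X a.toPath)) -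
      ∑ s : V, ∑ t : V, ∑ a : s ⟶ t,
        LinearMap.trace k (space X s) (v ⟨s, t, a⟩ ∘ₗ along Y a.toPath ∘ₗ u s) := by
    simp only [← Finset.sum_sub_distrib]
    rw [tracePairing_apply, Fintype.sum_sigma]
    refine Finset.sum_congr rfl fun s _ => ?_
    rw [Fintype.sum_sigma]
    refine Finset.sum_congr rfl fun t _ => Finset.sum_congr rfl fun a _ => ?_
    change LinearMap.trace k (space X s) (v ⟨s, t, a⟩ ∘ₗ
      (u t ∘ₗ along X a.toPath - along Y a.toPath ∘ₗ u s)) = _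
    rw [LinearMap.comp_sub, map_sub]
  rw [e₁, e₂, neg_sub]

variable {X Y} in
lemma finrank_range_codiff (hX : X.IsFiniteDim) (hY : Y.IsFiniteDim) :
    Module.finrank k (LinearMap.range (codiff X Y)) =
      Module.finrank k (LinearMap.range (diff X Y)) := by
  have hX' : ∀ x, Module.Finite k (space X x) := hX
  have hY' : ∀ x, Module.Finite k (space Y x) := hY
  exact finrank_range_of_adjoint (diff X Y) (codiff X Y) (tracePairing (space X) (space Y))
    (tracePairing (fun a : Arr V => space X a.1) (fun a => space Y a.2.1))
    (tracePairing_injective _ _) (tracePairing_injective _ _) (finrank_pi_hom_comm _ _)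
    (tracePairing_codiff hX hY)

/-- `⨁_{a : s ⟶ t} I t ⊗ X s`, indexed by the arrows. -/
abbrev tauTerm : QRep k V := coind (k := k) (fun a : Arr V => a.2.1) (fun a => space X a.1)

/-- Uncurrying of `nakayamaOne`. -/
def nakayamaOneIso : nakayamaOne.obj X ≅ tauTerm X where
  hom := homMk (M := nakayamaOne.obj X) (N := tauTerm X) (fun y =>
    { toFun := fun (φ : ∀ s t : V, (s ⟶ t) → Quiver.Path y t → space X s) =>
        (fun a q => φ a.1 a.2.1 a.2.2 q : ∀ a : Arr V, Quiver.Path y a.2.1 → space X a.1)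
      map_add' := fun _ _ => rfl
      map_smul' := fun _ _ => rfl }) fun _ _ _ _ => rfl
  inv := homMk (M := tauTerm X) (N := nakayamaOne.obj X) (fun y =>
    { toFun := fun (φ : ∀ a : Arr V, Quiver.Path y a.2.1 → space X a.1) =>
        (fun s t a q => φ ⟨s, t, a⟩ q : ∀ s t : V, (s ⟶ t) → Quiver.Path y t → space X s)
      map_add' := fun _ _ => rfl
      map_smul' := fun _ _ => rfl }) fun _ _ _ _ => rfl
  hom_inv_id := rfl
  inv_hom_id := rfl

/-- The component at `X` of `nakayamaMap`, with a coinduced target. -/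
def nakayamaDiff : nakayamaOne.obj X ⟶ resZero X := nakayamaMap.app X

/-- The inclusion of the kernel `τ X` of `nakayamaDiff X`. -/
def tauKernelι : tau X ⟶ nakayamaOne.obj X := kernel.ι (nakayamaMap.app X)

instance : Mono (tauKernelι X) := inferInstanceAs (Mono (kernel.ι (nakayamaMap.app X)))

lemma tauKernelι_nakayamaDiff : tauKernelι X ≫ nakayamaDiff X = 0 :=
  kernel.condition (nakayamaMap.app X)

lemma exists_lift_tauKernelι {Z : QRep k V} (h : Z ⟶ nakayamaOne.obj X)
    (hh : h ≫ nakayamaDiff X = 0) : ∃ l : Z ⟶ tau X, l ≫ tauKernelι X = h :=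
  ⟨kernel.lift (nakayamaMap.app X) h hh, kernel.lift_ι (nakayamaMap.app X) h hh⟩

/-- The Nakayama functor applied to the standard projective presentation, with its terms written as
coinduced representations. -/
def tauDiff : tauTerm X ⟶ resZero X := (nakayamaOneIso X).inv ≫ nakayamaDiff X

/-- The inclusion of `τ X` into an injective representation. -/
def tauι : tau X ⟶ tauTerm X := tauKernelι X ≫ (nakayamaOneIso X).hom

instance : Mono (tauι X) := mono_comp (tauKernelι X) (nakayamaOneIso X).hom

lemma tauι_tauDiff : tauι X ≫ tauDiff X = 0 := by
  rw [tauι, tauDiff, Category.assoc, Iso.hom_inv_id_assoc, tauKernelι_nakayamaDiff]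

lemma exists_lift_tauι {Z : QRep k V} (h : Z ⟶ tauTerm X) (hh : h ≫ tauDiff X = 0) :
    ∃ l : Z ⟶ tau X, l ≫ tauι X = h := by
  obtain ⟨l, hl⟩ := exists_lift_tauKernelι X (h ≫ (nakayamaOneIso X).inv)
    ((Category.assoc _ _ _).trans hh)
  refine ⟨l, ?_⟩
  rw [tauι, ← Category.assoc, hl, Category.assoc, Iso.inv_hom_id, Category.comp_id]

/-- The copresentation of `τ X` by injective representations. -/
abbrev tauComplex : ShortComplex (QRep k V) :=
  ShortComplex.mk (tauι X) (tauDiff X) (tauι_tauDiff X)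

lemma tauComplex_shortExact (h : Epi (nakayamaDiff X)) : (tauComplex X).ShortExact where
  exact := ShortComplex.exact_of_f_is_kernel _
    (KernelFork.IsLimit.ofι' (tauι X) (tauι_tauDiff X) fun g hg =>
      ⟨_, (exists_lift_tauι X g hg).choose_spec⟩)
  mono_f := inferInstanceAs (Mono (tauι X))
  epi_g := epi_comp (nakayamaOneIso X).inv (nakayamaDiff X)

/-- Evaluate at trivial paths: the value of h on a one-arrow path a is v_a Y(a) by naturality, and
the other sum already consists of X(a) v_a. -/
lemma coindHomEquiv_tauDiff (h : Y ⟶ tauTerm X) :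
    coindHomEquiv (fun x : V => x) (space X) Y (h ≫ tauDiff X) =
      codiff X Y (coindHomEquiv (fun a : Arr V => a.2.1) (fun a => space X a.1) Y h) := by
  funext x
  ext m
  change (∑ t : V, ∑ a : x ⟶ t,
      (show ∀ a : Arr V, Quiver.Path x a.2.1 → space X a.1 from compAt h x m) ⟨x, t, a⟩
        (Quiver.Path.nil.cons a)) -
      ∑ s : V, ∑ a : s ⟶ x, along X a.toPath
        ((show ∀ a : Arr V, Quiver.Path x a.2.1 → space X a.1 from compAt h x m) ⟨s, x, a⟩
          Quiver.Path.nil) =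
    ((_ - _ : space Y x →ₗ[k] space X x) m)
  simp only [LinearMap.sub_apply, LinearMap.sum_apply]
  refine congrArg₂ _ ?_ rfl
  refine Finset.sum_congr rfl fun t _ => Finset.sum_congr rfl fun a _ => ?_
  exact compAt_coind h m (⟨x, t, a⟩ : Arr V) (Quiver.Path.nil.cons a)

variable {X Y}

/-- The Auslander-Reiten formula `dim Hom(Y, τ X) = dim Ext¹(X, Y)`. -/
theorem finrank_hom_tau (hX : X.IsFiniteDim) (hY : Y.IsFiniteDim) :
    Module.Finite k (Y ⟶ tau X) ∧
      Module.finrank k (Y ⟶ tau X) = Module.finrank k (Abelian.Ext.{u + 1} X Y 1) := by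
  have hX' : ∀ x, Module.Finite k (space X x) := hX
  have hY' : ∀ x, Module.Finite k (space Y x) := hY
  let Ψ : (Y ⟶ tau X) →ₗ[k] (∀ a : Arr V, space Y a.2.1 →ₗ[k] space X a.1) :=
    (coindHomEquiv (fun a : Arr V => a.2.1) (fun a => space X a.1) Y).toLinearMap ∘ₗ
      Linear.rightComp k Y (tauι X)
  have hinj : Function.Injective Ψ := fun f g h =>
    (cancel_mono (tauι X)).1 ((coindHomEquiv _ _ Y).injective h)
  -- τX is the kernel of `tauDiff`, and Hom(Y, -) is left exact.
  have hrange : LinearMap.range Ψ = LinearMap.ker (codiff X Y) := by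
    ext v
    rw [LinearMap.mem_range, LinearMap.mem_ker]
    constructor
    · rintro ⟨f, rfl⟩
      change codiff X Y (coindHomEquiv _ _ Y (f ≫ tauι X)) = 0
      rw [← coindHomEquiv_tauDiff, Category.assoc, tauι_tauDiff, comp_zero, map_zero]
    · intro hv
      obtain ⟨l, hl⟩ := exists_lift_tauι X
        ((coindHomEquiv (fun a : Arr V => a.2.1) (fun a => space X a.1) Y).symm v) (by
          apply (coindHomEquiv (fun x : V => x) (space X) Y).injective
          rw [coindHomEquiv_tauDiff, LinearEquiv.apply_symm_apply, hv, map_zero])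
      refine ⟨l, ?_⟩
      change coindHomEquiv _ _ Y (l ≫ tauι X) = v
      rw [hl, LinearEquiv.apply_symm_apply]
  refine ⟨Module.Finite.of_injective Ψ hinj, ?_⟩
  -- The source of `codiff` and the target of `diff` have equal dimension, so equal rank gives dim
  -- ker `codiff` = dim coker `diff`.
  rw [← LinearMap.finrank_range_of_inj hinj, hrange, ← (extEquiv X Y).finrank_eq]
  have h₁ := (codiff X Y).finrank_range_add_finrank_ker
  have h₂ := (LinearMap.range (diff X Y)).finrank_quotient_add_finrank
  have h₃ := finrank_range_codiff hX hY
  have h₄ := finrank_pi_hom_comm (k := k) (fun a : Arr V => space X a.1) (fun a => space Y a.2.1)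
  omega

/-- The Auslander-Reiten formula `dim Ext¹(Y, τ X) = dim Hom(X, Y)`, for `X` whose Nakayama
presentation is onto. -/
theorem finrank_ext_tau (hX : X.IsFiniteDim) (hY : Y.IsFiniteDim)
    (h : Epi (nakayamaDiff X)) :
    Module.Finite k (Abelian.Ext.{u + 1} Y (tau X) 1) ∧
      Module.finrank k (Abelian.Ext.{u + 1} Y (tau X) 1) = Module.finrank k (X ⟶ Y) := by
  have hX' : ∀ x, Module.Finite k (space X x) := hX
  have hY' : ∀ x, Module.Finite k (space Y x) := hY
  have : Injective (tauComplex X).X₂ := inferInstanceAs (Injective (tauTerm X))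
  have hmap : (LinearMap.range (Linear.rightComp k Y (tauDiff X))).map
      (coindHomEquiv (fun x : V => x) (space X) Y).toLinearMap = LinearMap.range (codiff X Y) := by
    have hc : (coindHomEquiv (fun x : V => x) (space X) Y).toLinearMap ∘ₗ
        Linear.rightComp k Y (tauDiff X) = codiff X Y ∘ₗ
          (coindHomEquiv (fun a : Arr V => a.2.1) (fun a => space X a.1) Y).toLinearMap :=
      LinearMap.ext (coindHomEquiv_tauDiff X Y)
    exact ((LinearMap.range_comp _ _).symm.trans (congrArg LinearMap.range hc)).trans
      (LinearMap.range_comp_of_range_eq_top _ (LinearEquiv.range _))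
  let e := (Submodule.Quotient.equiv _ _ (coindHomEquiv (fun x : V => x) (space X) Y)
    hmap).symm.trans (extOneEquiv k (tauComplex_shortExact X h) Y)
  refine ⟨Module.Finite.equiv e, ?_⟩
  rw [← e.finrank_eq, (homEquiv X Y).finrank_eq]
  have h₁ := (diff X Y).finrank_range_add_finrank_ker
  have h₂ := (LinearMap.range (codiff X Y)).finrank_quotient_add_finrank
  have h₃ := finrank_range_codiff hX hY
  have h₄ := finrank_pi_hom_comm (k := k) (space X) (space Y)
  omega

end Codifferential

end QRep

end ClusterQuiver

end

noncomputable section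

namespace ClusterQuiver

/-! ### Finiteness of the set of paths. -/

section Paths

variable {V : Type} [Quiver.{0} V]

/-- The last arrow of a path, with the rest of the path, if there is one. -/
def splitLast {x : V} : ∀ {y : V}, Quiver.Path x y →
    Option (Σ e : (Σ z : V, (z ⟶ y)), Quiver.Path x e.1)
  | _, Quiver.Path.nil => none
  | _, Quiver.Path.cons q a => some ⟨⟨_, a⟩, q⟩

lemma splitLast_injective {x y : V} :
    Function.Injective (splitLast : Quiver.Path x y → _) := by
  intro p q h
  cases p with
  | nil =>
    cases q with
    | nil => rfl
    | cons q b => cases h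
  | cons p a =>
    cases q with
    | nil => cases h
    | cons q b =>
      cases h
      rfl

/-- A finite acyclic quiver has finitely many paths. -/
lemma finite_path [Finite V] [∀ x y : V, Finite (x ⟶ y)] (hV : IsAcyclicQuiver V) (x y : V) :
    Finite (Quiver.Path x y) := by
  -- By acyclicity, being joined by a nontrivial path is a strict order on the finite set V;
  -- well-founded induction on the endpoint then peels off last arrows.
  let r : V → V → Prop := fun a b => ∃ p : Quiver.Path a b, 0 < p.length
  have : IsTrans V r := ⟨fun a b c ⟨p, hp⟩ ⟨q, _⟩ => ⟨p.comp q, by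
    rw [Quiver.Path.length_comp]
    omega⟩⟩
  have : Std.Irrefl r := ⟨fun a ⟨p, hp⟩ => by
    rw [hV a p] at hp
    exact absurd hp (lt_irrefl 0)⟩
  induction y using (Finite.wellFounded_of_trans_of_irrefl r).induction with
  | _ y ih =>
    have (e : Σ z : V, (z ⟶ y)) : Finite (Quiver.Path x e.1) :=
      ih e.1 ⟨e.2.toPath, Nat.one_pos⟩
    exact Finite.of_injective _ splitLast_injective

end Paths

namespace QRep

variable {k : Type u} [Field k] {V : Type} [Quiver.{0} V]

/-! ### Projective representations and surjectivity of the Nakayama presentation. -/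

section Projective

variable (k) in
/-- The structure maps of the projective representation at a vertex: concatenation of paths. -/
def projAlong (y x z : V) (p : Quiver.Path x z) :
    (Quiver.Path y x →₀ k) →ₗ[k] (Quiver.Path y z →₀ k) :=
  Finsupp.lmapDomain k k fun q => q.comp p

variable (k) in
lemma projAlong_functorial (y : V) : IsFunctorial (projAlong k y) where
  nil _ _ := Finsupp.mapDomain_id
  comp p q φ := by
    refine Eq.trans ?_ Finsupp.mapDomain_comp
    exact congrArg (fun f => Finsupp.mapDomain f φ) (funext fun r => (r.comp_assoc p q).symm)

variable (k) in
/-- The projective representation at the vertex `y`. -/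
def proj (y : V) : QRep k V := mk (projAlong_functorial k y)

variable (k) in
/-- The generator of the projective representation at the vertex `y`. -/
def projGen (y : V) : space (proj k y) y :=
  (Finsupp.single Quiver.Path.nil 1 : Quiver.Path y y →₀ k)

lemma along_projGen (y : V) {x : V} (q : Quiver.Path y x) :
    along (proj k y) q (projGen k y) = (Finsupp.single q 1 : Quiver.Path y x →₀ k) :=
  Finsupp.mapDomain_single.trans (congrArg (fun r => Finsupp.single r 1) q.nil_comp)

lemma linearCombination_projAlong {Y : QRep k V} {y : V} (m : space Y y) {x z : V}
    (p : Quiver.Path x z) :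
    (Finsupp.linearCombination k fun q : Quiver.Path y z => along Y q m) ∘ₗ projAlong k y x z p =
      along Y p ∘ₗ Finsupp.linearCombination k fun q : Quiver.Path y x => along Y q m := by
  refine Finsupp.lhom_ext fun q c => ?_
  rw [LinearMap.comp_apply, LinearMap.comp_apply, projAlong, Finsupp.lmapDomain_apply,
    Finsupp.mapDomain_single, Finsupp.linearCombination_single, Finsupp.linearCombination_single,
    map_smul, along_comp]

/-- The morphism from the projective representation at `y` given by an element. -/
def projHom {Y : QRep k V} {y : V} (m : space Y y) : proj k y ⟶ Y :=
  homMk (M := proj k y) (fun x => Finsupp.linearCombination k fun q : Quiver.Path y x => along Y q m)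
    fun _ _ p => LinearMap.congr_fun (linearCombination_projAlong m p)

lemma projHom_projGen {Y : QRep k V} {y : V} (m : space Y y) :
    compAt (projHom m) y (projGen k y) = m := by
  refine (Finsupp.linearCombination_single k 1 Quiver.Path.nil).trans ?_
  rw [one_smul, along_nil]

lemma proj_hom_ext {Y : QRep k V} {y : V} {f g : proj k y ⟶ Y}
    (h : compAt f y (projGen k y) = compAt g y (projGen k y)) : f = g := by
  refine hom_ext fun x (φ : Quiver.Path y x →₀ k) => ?_
  induction φ using Finsupp.induction_linear with
  | zero => exact (map_zero _).trans (map_zero _).symm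
  | add φ ψ hφ hψ => exact (map_add _ _ _).trans ((congrArg₂ _ hφ hψ).trans (map_add _ _ _).symm)
  | single q c =>
    have e : (Finsupp.single q c : Quiver.Path y x →₀ k) =
        c • (along (proj k y) q (projGen k y) : space (proj k y) x) := by
      rw [along_projGen]
      exact (Finsupp.smul_single_one q c).symm
    rw [e, map_smul, map_smul, compAt_along, compAt_along, h]

instance (y : V) : Projective (proj k y) where
  factors {E X} f e he := by
    obtain ⟨m, hm⟩ := (epi_iff e).1 he y (compAt f y (projGen k y))
    exact ⟨projHom m, proj_hom_ext (by rw [compAt_comp, projHom_projGen, hm])⟩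

lemma proj_isFiniteDim (y : V) (h : ∀ x : V, Finite (Quiver.Path y x)) :
    (proj k y).IsFiniteDim := fun x => by
  have := h x
  exact inferInstanceAs (Module.Finite k (Quiver.Path y x →₀ k))

/-- Subrepresentations of projective representations are projective. -/
lemma projective_of_mono {S P : QRep k V} (i : S ⟶ P) [Mono i] [Projective P] : Projective S := by
  rw [projective_iff_subsingleton_ext_one]
  intro Y
  have hS : (ShortComplex.mk i (cokernel.π i) (cokernel.condition i)).ShortExact :=
    { exact := ShortComplex.exact_of_g_is_cokernel _ (cokernelIsCokernel i) }
  refine subsingleton_of_forall_eq 0 fun (x : Abelian.Ext.{u + 1} S Y 1) => ?_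
  -- The obstruction to extending a class from S to P lies in Ext² of the cokernel.
  have := subsingleton_ext_two (cokernel i) Y
  obtain ⟨y, rfl⟩ := Abelian.Ext.contravariant_sequence_exact₁ hS Y x (n₁ := 2) rfl
    (Subsingleton.elim _ _)
  rw [Abelian.Ext.eq_zero_of_projective y, Abelian.Ext.comp_zero]

/-- The image of f is a subobject of a projective, hence projective, so it splits off X and must
vanish. -/
lemma hom_eq_zero_of_noProjectiveSummand {X P : QRep k V} (hX : X.NoProjectiveSummand)
    [Projective P] (f : X ⟶ P) : f = 0 := by
  have hproj : Projective (Limits.image f) := projective_of_mono (Limits.image.ι f)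
  have hS : (ShortComplex.mk (kernel.ι (factorThruImage f)) (factorThruImage f)
      (kernel.condition _)).ShortExact :=
    { exact := ShortComplex.exact_of_f_is_kernel _ (kernelIsKernel _) }
  have : Projective (ShortComplex.mk (kernel.ι (factorThruImage f)) (factorThruImage f)
    (kernel.condition _)).X₃ := hproj
  have hz : IsZero (Limits.image f) := hX _ _ hproj
    ⟨hS.splittingOfProjective.isoBinaryBiproduct ≪≫ biprod.braiding _ _⟩
  rw [← Limits.image.fac f, hz.eq_zero_of_src (Limits.image.ι f), comp_zero]

variable [Fintype V] [∀ x y : V, Fintype (x ⟶ y)]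

/-- Elements at y are maps from the projective P_y, so it suffices that `codiff X P_y` is onto. Its
transpose `diff X P_y` is injective because Hom(X, P_y) = 0, and acyclicity makes P_y
finite-dimensional, so ranks can be compared. -/
lemma epi_nakayamaDiff (hV : IsAcyclicQuiver V) {X : QRep k V} (hX : X.IsFiniteDim)
    (hproj : X.NoProjectiveSummand) : Epi (nakayamaDiff X) := by
  suffices h : Epi (tauDiff X) by
    have : Epi ((nakayamaOneIso X).inv ≫ nakayamaDiff X) := h
    exact epi_of_epi (nakayamaOneIso X).inv (nakayamaDiff X)
  rw [epi_iff]
  intro y ψ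
  have hY : (proj k y).IsFiniteDim := proj_isFiniteDim y fun x => finite_path hV y x
  have hX' : ∀ x, Module.Finite k (space X x) := hX
  have hY' : ∀ x, Module.Finite k (space (proj k y) x) := hY
  have hker : LinearMap.ker (diff X (proj k y)) = ⊥ := by
    rw [LinearMap.ker_eq_bot']
    intro u hu
    have h0 := hom_eq_zero_of_noProjectiveSummand hproj
      ((homEquiv X (proj k y)).symm ⟨u, LinearMap.mem_ker.2 hu⟩)
    rw [LinearEquiv.map_eq_zero_iff] at h0
    exact congrArg Subtype.val h0
  have hsurj : LinearMap.range (codiff X (proj k y)) = ⊤ := by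
    apply Submodule.eq_top_of_finrank_eq
    rw [finrank_range_codiff hX hY, LinearMap.finrank_range_of_inj (LinearMap.ker_eq_bot.1 hker)]
    exact (finrank_pi_hom_comm _ _).symm
  obtain ⟨v, hv⟩ := LinearMap.range_eq_top.1 hsurj
    (coindHomEquiv (fun x : V => x) (space X) (proj k y) (projHom (Y := resZero X) ψ))
  refine ⟨compAt ((coindHomEquiv (fun a : Arr V => a.2.1) (fun a => space X a.1)
    (proj k y)).symm v) y (projGen k y), ?_⟩
  rw [← compAt_comp]
  have : (coindHomEquiv (fun a : Arr V => a.2.1) (fun a => space X a.1) (proj k y)).symm v ≫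
      tauDiff X = projHom (Y := resZero X) ψ := by
    apply (coindHomEquiv (fun x : V => x) (space X) (proj k y)).injective
    rw [coindHomEquiv_tauDiff, LinearEquiv.apply_symm_apply, hv]
  rw [this, projHom_projGen]

end Projective

end QRep

/-! ### Euler form under isomorphism, and the bound from the cluster category. -/

section Cluster

variable {k : Type u} [Field k] {V : Type} [Quiver.{0} V]

lemma eulerForm_congr_left {M M' : QRep k V} (e : M ≅ M') (N : QRep k V) :
    eulerForm M N = eulerForm M' N := by
  have h : Function.Bijective (Abelian.Ext.precompOfLinear (Abelian.Ext.mk₀ e.hom) k N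
      (zero_add 1) : Abelian.Ext.{u + 1} M' N 1 →ₗ[k] Abelian.Ext.{u + 1} M N 1) := by
    refine Function.bijective_iff_has_inverse.2
      ⟨fun x => (Abelian.Ext.mk₀ e.inv).comp x (zero_add 1), fun x => ?_, fun x => ?_⟩
    · change (Abelian.Ext.mk₀ e.inv).comp
        ((Abelian.Ext.mk₀ e.hom).comp x (zero_add 1)) (zero_add 1) = x
      rw [Abelian.Ext.mk₀_comp_mk₀_assoc, e.inv_hom_id, Abelian.Ext.mk₀_id_comp]
    · change (Abelian.Ext.mk₀ e.hom).comp ((Abelian.Ext.mk₀ e.inv).comp x (zero_add 1)) (zero_add 1) = x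
      rw [Abelian.Ext.mk₀_comp_mk₀_assoc, e.hom_inv_id, Abelian.Ext.mk₀_id_comp]
  rw [eulerForm, eulerForm, (Linear.homCongr k e (Iso.refl N)).finrank_eq,
    (LinearEquiv.ofBijective _ h).finrank_eq]

variable [Fintype V] [∀ x y : V, Fintype (x ⟶ y)]

/-- `Ext¹` of modules embeds into `Ext¹` of the cluster category, as the summand of index `0`. -/
def extToCluster (M N : QRep k V) : Abelian.Ext.{u + 1} M N 1 →ₗ[k] ClusterExtOne M N :=
  (DirectSum.lof k ℤ (fun i : ℤ =>
      (DerivedCategory.Q.obj ((CochainComplex.singleFunctor (QRep k V) 0).obj M) ⟶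
        DerivedCategory.Q.obj (orbitPow i
          (((CochainComplex.singleFunctor (QRep k V) 0).obj N)⟦(1 : ℤ)⟧)))) 0) ∘ₗ
    (Abelian.Ext.homLinearEquiv (R := k) ≪≫ₗ Linear.homCongr k (Iso.refl (DerivedCategory.Q.obj
        ((CochainComplex.singleFunctor (QRep k V) 0).obj M)))
      ((DerivedCategory.Q.commShiftIso (1 : ℤ)).app
        ((CochainComplex.singleFunctor (QRep k V) 0).obj N)).symm).toLinearMap

lemma extToCluster_injective (M N : QRep k V) : Function.Injective (extToCluster M N) :=
  (DirectSum.of_injective (0 : ℤ)).comp (LinearEquiv.injective _)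

lemma finrank_ext_le_of_clusterExtOne {M N : QRep k V}
    (h : Module.finrank k (ClusterExtOne M N) = 1) :
    Module.finrank k (Abelian.Ext.{u + 1} M N 1) ≤ 1 := by
  -- Positivity of `finrank` excludes the default value 0 of infinite dimension; without finiteness
  -- the embedding would bound nothing.
  have : Module.Finite k (ClusterExtOne M N) := Module.finite_of_finrank_pos (by omega)
  exact (LinearMap.finrank_le_finrank_of_injective (extToCluster_injective M N)).trans h.le

end Cluster

end ClusterQuiver

end

/-! ### The main theorem. -/

theorem mainTheorem5 {k : Type u} [Field k] [Finite k] {V : Type} [Fintype V] [Quiver.{0} V]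
    [∀ x y : V, Fintype (x ⟶ y)] (hV : ClusterQuiver.IsAcyclicQuiver V) (frozen : Set V)
    (M N : ClusterQuiver.QRep k V)
    (hM : M.IsFiniteDim) (hN : N.IsFiniteDim)
    (hMQ : M.IsOverPrincipalPart frozen) (hNQ : N.IsOverPrincipalPart frozen)
    (hMind : Indecomposable M) (hNind : Indecomposable N)
    (hMrig : ClusterQuiver.IsRigid M) (hNrig : ClusterQuiver.IsRigid N)
    (hMN : Module.finrank k (ClusterQuiver.ClusterExtOne M N) = 1)
    (D₀ A A₀ I M' P₀ : ClusterQuiver.QRep k V)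
    (hI : Injective I) (hP₀ : Projective P₀) (hA : A.IsFiniteDim)
    (hAproj : A.NoProjectiveSummand) (hM'proj : M'.NoProjectiveSummand)
    (eM : M ≅ M' ⊞ P₀) (eA₀ : A₀ ≅ A ⊞ P₀)
    (j : D₀ ⟶ N) (f : N ⟶ ClusterQuiver.tau M) (p : ClusterQuiver.tau M ⟶ ClusterQuiver.tau A ⊞ I)
    (hj : Mono j) (hp : Epi p) (hf : f ≠ 0) (hjf : j ≫ f = 0) (hfp : f ≫ p = 0)
    (hN_exact : (ShortComplex.mk j f hjf).Exact)
    (hτM_exact : (ShortComplex.mk f p hfp).Exact) :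
    (1 / 2 : ℚ) * (ClusterQuiver.eulerForm A₀ D₀ : ℚ) -
      (1 / 2 : ℚ) * (ClusterQuiver.eulerForm M N : ℚ) = 1 / 2 := by
  have hext : Module.finrank k (Abelian.Ext.{u + 1} M N 1) ≤ 1 :=
    ClusterQuiver.finrank_ext_le_of_clusterExtOne hMN
  obtain ⟨hfin, hhom⟩ := ClusterQuiver.QRep.finrank_hom_tau hM hN
  have hpos : 0 < Module.finrank k (N ⟶ ClusterQuiver.tau M) :=
    Module.finrank_pos_iff_exists_ne_zero.2 ⟨f, hf⟩
  -- Upper bound from the cluster category, lower bound from f ≠ 0.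
  have hone : Module.finrank k (N ⟶ ClusterQuiver.tau M) = 1 := by omega
  have hnotproj : ¬Projective M := fun h => by
    have hsub := Abelian.Ext.subsingleton_of_projective.{u + 1} M N 0
    have := Module.finrank_zero_of_subsingleton (R := k) (M := Abelian.Ext.{u + 1} M N 1)
    omega
  -- In M ≅ P ⊞ X either P = 0, or X = 0 and M ≅ P would be projective.
  have hMproj : M.NoProjectiveSummand := fun P X hP ⟨e⟩ =>
    (hMind.2 P X e).resolve_right fun hX =>
      hnotproj (Projective.of_iso (e ≪≫ (isoBiprodZero hX).symm).symm hP)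
  have hP₀zero : IsZero P₀ := hMproj P₀ M' hP₀ ⟨eM ≪≫ biprod.braiding M' P₀⟩
  have hD₀ : D₀.IsFiniteDim := hN.of_mono j
  have hE : ClusterQuiver.QRep.IsFiniteDim (Limits.image f) := hN.of_epi (factorThruImage f)
  have hET : Subsingleton (Abelian.Ext.{u + 1} (Limits.image f) (ClusterQuiver.tau M) 1) := by
    obtain ⟨hfin', hdim⟩ := ClusterQuiver.QRep.finrank_ext_tau hM hE
      (ClusterQuiver.QRep.epi_nakayamaDiff hV hM hMproj)
    obtain ⟨hfinM, hdimM⟩ := ClusterQuiver.QRep.finrank_hom_tau hM hM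
    have hMrig' : Subsingleton (Abelian.Ext.{u + 1} M M 1) := hMrig
    rw [Module.finrank_zero_of_subsingleton (M := Abelian.Ext.{u + 1} M M 1)] at hdimM
    -- Zero `finrank` means zero space only thanks to `hfinM`, the finiteness half of the
    -- Auslander-Reiten formula.
    have hMM : Subsingleton (M ⟶ ClusterQuiver.tau M) := Module.finrank_zero_iff.1 hdimM
    have hME : Subsingleton (M ⟶ Limits.image f) := ⟨fun g h =>
      (cancel_mono (Limits.image.ι f)).1 (Subsingleton.elim _ _)⟩
    rw [Module.finrank_zero_of_subsingleton (M := M ⟶ Limits.image f)] at hdim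
    exact Module.finrank_zero_iff.1 hdim
  obtain ⟨hzero, hdim⟩ := ClusterQuiver.hom_ext_of_exact k
    ClusterQuiver.QRep.subsingleton_ext_two j f p hjf hfp hN_exact hτM_exact hNrig
    (fun g => ((finrank_eq_one_iff_of_nonzero' f hf).1 hone g).imp fun c hc => hc.symm) hET
  have hDA : Module.finrank k (D₀ ⟶ ClusterQuiver.tau A) = 0 := by
    have : Subsingleton (D₀ ⟶ ClusterQuiver.tau A) := subsingleton_of_forall_eq 0 hzero
    exact Module.finrank_zero_of_subsingleton
  have hA₁ := (ClusterQuiver.QRep.finrank_hom_tau hA hD₀).2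
  have hA₂ := (ClusterQuiver.QRep.finrank_ext_tau hA hD₀
    (ClusterQuiver.QRep.epi_nakayamaDiff hV hA hAproj)).2
  have hM₂ := (ClusterQuiver.QRep.finrank_ext_tau hM hN
    (ClusterQuiver.QRep.epi_nakayamaDiff hV hM hMproj)).2
  -- ⟨A₀, D₀⟩ = dim Hom(M, N) - 0, while ⟨M, N⟩ = dim Hom(M, N) - 1.
  have key : ClusterQuiver.eulerForm A₀ D₀ = ClusterQuiver.eulerForm M N + 1 := by
    rw [ClusterQuiver.eulerForm_congr_left (eA₀ ≪≫ (isoBiprodZero hP₀zero).symm),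
      ClusterQuiver.eulerForm, ClusterQuiver.eulerForm]
    omega
  rw [key]
  push_cast
  ring
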